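/- Let $N,K\ge 1$ be integers, let $\sigma>0$, $N_0=2\sigma^2$ and $\Delta>0$. Let $\mathbf X$ be a random vector in $\mathbb R^N$ whose distribution is the equal-weight mixture (probability $1/K$ each) of the uniform distributions on the $K$ hyperspheres centred at the origin with radii $s_k=k\sigma\Delta$, $k=1,\dots,K$. Let $\mathbf Y=\mathbf X+\mathbf N$, where $\mathbf N$ is independent of $\mathbf X$ and has independent Gaussian components with mean $0$ and variance $\sigma^2$. Let $A=\mathbb E[\|\mathbf X\|^2]/N_0$ be the signal-to-noise ratio. Then $$\Delta=\sqrt{\frac{12A}{2K^2+3K+1}},$$ the random variable $\tilde R=\|\mathbf Y\|/\sigma$ has on $(0,\infty)$ the probability density $$f_{\tilde R}(\tilde r)=\frac1K\sum_{k=1}^K\chi(\tilde r,k\Delta),\qquad \chi(\tilde r,\tilde s)=\frac{\tilde r^{N/2}}{\tilde s^{N/2-1}}\exp\!\left(-\frac{\tilde r^2+\tilde s^2}{2}\right)I_{N/2-1}(\tilde r\tilde s),$$ where $I_\nu$ is the modified Bessel function of the first kind of order $\nu$, and the mutual information $I(\mathbf X;\mathbf Y)=h(\mathbf Y)-h(\mathbf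 Y\,|\,\mathbf X)$ in bits (where $h(\mathbf Y)=-\int f_{\mathbf Y}\log_2 f_{\mathbf Y}$ is the differential entropy and $h(\mathbf Y\,|\,\mathbf X)$ is the average over $\mathbf X$ of the differential entropy of the conditional distribution of $\mathbf Y$ given $\mathbf X$) is $$I(\mathbf X;\mathbf Y)=-\int_0^\infty f_{\tilde R}(\tilde r)\log_2\frac{f_{\tilde R}(\tilde r)}{\tilde r^{N-1}}\,d\tilde r+\log_2\frac{2}{\Gamma(N/2)}-\frac N2\log_2(2e),$$ all the entropies and the integral being well defined and finite. -/

import Mathlib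

open MeasureTheory ProbabilityTheory Set
open scoped ENNReal

noncomputable section

/-- The modified Bessel function of the first kind `I_ν(x)` of real order `ν`, for real `x ≥ 0`:
`(x/2)^ν ∑_m (x²/4)^m / (m! Γ(m + ν + 1))`. -/
def besselI (ν x : ℝ) : ℝ :=
  (x / 2) ^ ν * ∑' m : ℕ, (x ^ 2 / 4) ^ m / ((m.factorial : ℝ) * Real.Gamma (m + ν + 1))

/-- The noncentral chi density with `N` degrees of freedom and noncentrality parameter `s`:
`χ(r, s) = r^{N/2} / s^{N/2-1} · exp(-(r² + s²)/2) · I_{N/2-1}(r s)`. -/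
def chiDensity (N : ℕ) (r s : ℝ) : ℝ :=
  r ^ ((N : ℝ) / 2) / s ^ ((N : ℝ) / 2 - 1) * Real.exp (-(r ^ 2 + s ^ 2) / 2)
    * besselI ((N : ℝ) / 2 - 1) (r * s)

/-- The uniform probability distribution on the hypersphere of radius `s` centred at the origin
of `ℝ^N` (the normalized surface measure of the unit sphere, scaled by `s`). -/
def sphereUniform (N : ℕ) (s : ℝ) : Measure (EuclideanSpace ℝ (Fin N)) :=
  (((volume : Measure (EuclideanSpace ℝ (Fin N))).toSphere univ)⁻¹ •
    (volume : Measure (EuclideanSpace ℝ (Fin N))).toSphere).map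
      (fun u : Metric.sphere (0 : EuclideanSpace ℝ (Fin N)) 1 => s • u.1)

/-- The `N`-dimensional multisphere distribution with `K` concentric hyperspheres: hypersphere
`k = 1, …, K` has probability `p k` and radius `s k`, and the points on it are uniformly
distributed. -/
def multisphere (N K : ℕ) (p : ℕ → ℝ≥0∞) (s : ℕ → ℝ) : Measure (EuclideanSpace ℝ (Fin N)) :=
  ∑ k ∈ Finset.Icc 1 K, p k • sphereUniform N (s k)

/-- The distribution of `N`-dimensional white Gaussian noise with mean `0` and variance `σ²`
per real dimension. -/
def gaussianNoise (N : ℕ) (σ : ℝ) : Measure (EuclideanSpace ℝ (Fin N)) :=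
  (stdGaussian (EuclideanSpace ℝ (Fin N))).map (fun z => σ • z)

section Entropy

variable {E : Type*} [MeasureSpace E]

/-- The distribution `μ` has a density `f` and `f log₂ f` is integrable, that is, the
differential entropy of `μ` is well defined and finite. -/
def HasDiffEntropy (μ : Measure E) : Prop :=
  μ ≪ volume ∧ Integrable (fun y =>
    (μ.rnDeriv volume y).toReal * Real.logb 2 (μ.rnDeriv volume y).toReal) volume

/-- The differential entropy, in bits, `-∫ f log₂ f` of a distribution with density `f`. -/
def diffEntropy (μ : Measure E) : ℝ :=
  -∫ y, (μ.rnDeriv volume y).toReal * Real.logb 2 (μ.rnDeriv volume y).toReal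

variable [StandardBorelSpace E] [Nonempty E] {Ω : Type*} [MeasurableSpace Ω]

/-- The conditional differential entropy `h(Y | X)`, in bits: the average over `X` of the
differential entropy of the conditional distribution of `Y` given `X = x`. -/
def condDiffEntropy (Y X : Ω → E) (P : Measure Ω) [IsFiniteMeasure P] : ℝ :=
  ∫ x, diffEntropy (condDistrib Y X P x) ∂(P.map X)

/-- The mutual information `I(X; Y) = h(Y) - h(Y | X)`, in bits. -/
def mutualInfo (X Y : Ω → E) (P : Measure Ω) [IsFiniteMeasure P] : ℝ :=
  diffEntropy (P.map Y) - condDiffEntropy Y X P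

/-- All the entropies in `I(X; Y) = h(Y) - h(Y | X)` are well defined and finite. -/
def MutualInfoDefined (X Y : Ω → E) (P : Measure Ω) [IsFiniteMeasure P] : Prop :=
  HasDiffEntropy (P.map Y) ∧
    (∀ᵐ x ∂(P.map X), HasDiffEntropy (condDistrib Y X P x)) ∧
    Integrable (fun x => diffEntropy (condDistrib Y X P x)) (P.map X)

end Entropy

/-- The density `(1/K) ∑_{k=1}^K χ(r, kΔ)`. -/
def uniformRadialDensity (N K : ℕ) (Δ r : ℝ) : ℝ :=
  (1 / (K : ℝ)) * ∑ k ∈ Finset.Icc 1 K, chiDensity N r (k * Δ)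

end

/-! Everything rests on the density of `Y` being a function of `‖y‖` alone. Averaging the Gaussian
density at `y - s u` over the unit sphere leaves only the cross term `s⟪y, u⟫ / σ²` depending on
`u`, so the average is a Gaussian factor times the Laplace transform of the uniform distribution on
the sphere. That transform is a power series in the squared norm (`hasSum_integral_exp_inner`) and
is, up to a power and a Gamma factor, the Bessel function of order `N/2 - 1`. Its moments come from
computing one Gaussian integral in two ways, in polar coordinates and through a one-dimensional
marginal (`toSphere_inner_pow_mul`).

Write `g = radialProfile`. Then `f_Y(y) = (2πσ²)^(-N/2) g(‖y‖/σ)`, while by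
`uniformRadialDensity_eq` the radial density is a constant times `r^(N-1) g(r)`. Polar coordinates
turn integrals of `h(‖y‖/σ) f_Y(y)` into integrals of `h` against the radial density: indicators `h`
give the law of `‖Y‖/σ`, and `h = log₂ g` gives the entropy. Both `log₂ f_Y` and `log₂ (f_R̃ /
r^(N-1))` are `log₂ g` plus explicit constants, so the two entropy integrals differ by a constant.
Finiteness holds because `g` lies between a Gaussian-type lower bound and `1`, so `|log₂ g|` grows
at most quadratically while `Y` has a second moment.

Given `X = x`, the output is Gaussian noise centred at `x`, whose entropy does not depend on `x`;
subtracting it removes `π` and `σ`. The formula for `Δ` is the sum of the first `K` squares. -/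

/-! ### Gaussian noise: density, second moment, entropy -/

/-- The density of `gaussianNoise N σ`. -/
noncomputable def gaussDensity (N : ℕ) (σ : ℝ) (z : EuclideanSpace ℝ (Fin N)) : ℝ :=
  (2 * Real.pi * σ ^ 2) ^ (-((N : ℝ) / 2)) * Real.exp (-‖z‖ ^ 2 / (2 * σ ^ 2))

lemma gaussDensity_pos (N : ℕ) {σ : ℝ} (hσ : 0 < σ) (z : EuclideanSpace ℝ (Fin N)) :
    0 < gaussDensity N σ z := by
  unfold gaussDensity
  have := Real.pi_pos
  positivity

@[fun_prop]
lemma continuous_gaussDensity (N : ℕ) (σ : ℝ) : Continuous (gaussDensity N σ) := by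
  unfold gaussDensity
  fun_prop

lemma integrable_gaussDensity (N : ℕ) {σ : ℝ} (hσ : 0 < σ) :
    Integrable (gaussDensity N σ) := by
  have hb : 0 < ((1 / (2 * σ ^ 2) : ℝ) : ℂ).re := by
    rw [Complex.ofReal_re]; positivity
  have h := (GaussianFourier.integrable_cexp_neg_mul_sq_norm_add hb 0
    (0 : EuclideanSpace ℝ (Fin N))).re
  refine (h.const_mul ((2 * Real.pi * σ ^ 2) ^ (-((N : ℝ) / 2)))).congr (ae_of_all _ fun z => ?_)
  simp only [gaussDensity]
  congr 1
  rw [show (-((1 / (2 * σ ^ 2) : ℝ) : ℂ) * (‖z‖ : ℂ) ^ 2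
      + 0 * ((inner ℝ (0 : EuclideanSpace ℝ (Fin N)) z : ℝ) : ℂ))
      = ((-‖z‖ ^ 2 / (2 * σ ^ 2) : ℝ) : ℂ) by push_cast; ring]
  rw [← Complex.ofReal_exp]
  exact Complex.ofReal_re _

/-- Centred white Gaussian noise has the density `gaussDensity`. -/
lemma gaussianNoise_eq_withDensity (N : ℕ) {σ : ℝ} (hσ : 0 < σ) :
    gaussianNoise N σ = volume.withDensity (fun z => ENNReal.ofReal (gaussDensity N σ z)) := by
  have hpi := Real.pi_pos
  have := isFiniteMeasure_withDensity_ofReal (integrable_gaussDensity N hσ).2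
  have : IsFiniteMeasure (gaussianNoise N σ) := by
    unfold gaussianNoise; infer_instance
  -- Finite measures are determined by their characteristic functions; both sides give
  -- `exp(-σ²‖t‖²/2)`.
  apply Measure.ext_of_charFun
  ext t
  have h1 : charFun (gaussianNoise N σ) t = Complex.exp (-(σ ^ 2 * ‖t‖ ^ 2) / 2) := by
    rw [gaussianNoise, charFun_map_smul, charFun_stdGaussian, norm_smul, Real.norm_eq_abs,
      abs_of_pos hσ]
    push_cast
    ring_nf
  have hb : 0 < ((1 / (2 * σ ^ 2) : ℝ) : ℂ).re := by
    rw [Complex.ofReal_re]; positivity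
  have h2 := GaussianFourier.integral_cexp_neg_mul_sq_norm_add hb Complex.I t
  rw [h1, charFun_apply, integral_withDensity_eq_integral_toReal_smul (by fun_prop) (by simp)]
  have hc : ((Real.pi : ℂ) / ((1 / (2 * σ ^ 2) : ℝ) : ℂ)) ^
      ((Module.finrank ℝ (EuclideanSpace ℝ (Fin N)) : ℂ) / 2)
      = (((2 * Real.pi * σ ^ 2) ^ ((N : ℝ) / 2) : ℝ) : ℂ) := by
    rw [Complex.ofReal_cpow (by positivity)]
    simp only [finrank_euclideanSpace, Fintype.card_fin]
    push_cast
    congr 1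
    field_simp
  rw [hc] at h2
  have : ∀ z : EuclideanSpace ℝ (Fin N),
      (ENNReal.ofReal (gaussDensity N σ z)).toReal • Complex.exp ((inner ℝ z t : ℝ) * Complex.I)
      = (((2 * Real.pi * σ ^ 2) ^ (-((N : ℝ) / 2)) : ℝ) : ℂ) *
        Complex.exp (-((1 / (2 * σ ^ 2) : ℝ) : ℂ) * ‖z‖ ^ 2
          + Complex.I * ((inner ℝ t z : ℝ) : ℂ)) := by
    intro z
    rw [ENNReal.toReal_ofReal (gaussDensity_pos N hσ z).le, gaussDensity, Complex.real_smul,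
      Complex.ofReal_mul, mul_assoc, Complex.ofReal_exp, ← Complex.exp_add, real_inner_comm]
    congr 3
    · push_cast; ring
    · ring
  simp_rw [this]
  rw [integral_const_mul, h2, ← mul_assoc, ← Complex.ofReal_mul, ← Real.rpow_add (by positivity)]
  simp only [neg_add_cancel, Real.rpow_zero, Complex.ofReal_one, one_mul]
  congr 1
  have : (σ : ℂ) ≠ 0 := by exact_mod_cast hσ.ne'
  push_cast
  rw [Complex.I_sq]
  field_simp
  ring

instance isProbabilityMeasure_gaussianNoise (N : ℕ) (σ : ℝ) :
    IsProbabilityMeasure (gaussianNoise N σ) :=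
  Measure.isProbabilityMeasure_map (Measurable.aemeasurable (by fun_prop))

lemma memLp_two_gaussianNoise (N : ℕ) (σ : ℝ) : MemLp id 2 (gaussianNoise N σ) := by
  rw [gaussianNoise, memLp_map_measure_iff (by fun_prop) (by fun_prop)]
  exact (IsGaussian.memLp_two_id (μ := stdGaussian (EuclideanSpace ℝ (Fin N)))).const_smul σ

lemma map_inner_stdGaussian {N : ℕ} (v : EuclideanSpace ℝ (Fin N)) (hv : ‖v‖ = 1) :
    (stdGaussian (EuclideanSpace ℝ (Fin N))).map (fun x => inner ℝ v x) = gaussianReal 0 1 := by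
  have h := IsGaussian.map_eq_gaussianReal (μ := stdGaussian (EuclideanSpace ℝ (Fin N)))
    (innerSL ℝ v)
  rw [integral_strongDual_stdGaussian, variance_dual_stdGaussian] at h
  rw [innerSL_apply_norm, hv] at h
  simpa using h

/-- The noise power per `N` real dimensions. -/
lemma integral_norm_sq_gaussianNoise (N : ℕ) (σ : ℝ) :
    ∫ z, ‖z‖ ^ 2 ∂(gaussianNoise N σ) = N * σ ^ 2 := by
  rw [gaussianNoise, integral_map (by fun_prop) (by fun_prop)]
  simp_rw [norm_smul, mul_pow, EuclideanSpace.real_norm_sq_eq]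
  rw [integral_const_mul, integral_finsetSum]
  · have : ∀ i : Fin N, ∫ x : EuclideanSpace ℝ (Fin N), x i ^ 2
        ∂(stdGaussian (EuclideanSpace ℝ (Fin N))) = 1 := by
      intro i
      have hm := map_inner_stdGaussian (EuclideanSpace.basisFun (Fin N) ℝ i) (by simp)
      have h2 : ∫ x, x ^ 2 ∂(gaussianReal 0 1) = 1 := by
        have := variance_of_integral_eq_zero (X := id) (μ := gaussianReal 0 1) (by fun_prop)
          (by simp)
        simpa using this.symm
      rw [← hm, integral_map (by fun_prop) (by fun_prop)] at h2
      simpa [EuclideanSpace.inner_single_left] using h2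
    simp [this, mul_comm]
  · intro i _
    have h := (IsGaussian.memLp_two_id (μ := stdGaussian (EuclideanSpace ℝ (Fin N))))
    refine (h.integrable_norm_pow (by norm_num)).mono (by fun_prop) (ae_of_all _ fun x => ?_)
    simp only [Real.norm_eq_abs, abs_pow, sq_abs, id, abs_norm]
    have := PiLp.norm_apply_le x i
    rw [Real.norm_eq_abs] at this
    calc x i ^ 2 = |x i| ^ 2 := (sq_abs _).symm
      _ ≤ _ := by gcongr

lemma map_add_left_withDensity {N : ℕ} (f : EuclideanSpace ℝ (Fin N) → ℝ≥0∞)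
    (x : EuclideanSpace ℝ (Fin N)) :
    (volume.withDensity f).map (fun z => x + z) = volume.withDensity (fun y => f (y - x)) := by
  ext s hs
  rw [Measure.map_apply (by fun_prop) hs, withDensity_apply _ hs,
    withDensity_apply _ (by exact measurable_const_add x hs),
    ← lintegral_indicator hs, ← lintegral_indicator (by exact measurable_const_add x hs),
    ← lintegral_add_left_eq_self (s.indicator fun y => f (y - x)) x]
  simp only [indicator, add_sub_cancel_left]
  rfl

/-- Gaussian noise centred at `x` has finite differential entropy `N/2 log₂ (2 π e σ²)`. -/
lemma gaussianNoise_entropy (N : ℕ) {σ : ℝ} (hσ : 0 < σ) (x : EuclideanSpace ℝ (Fin N)) :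
    HasDiffEntropy ((gaussianNoise N σ).map (fun z => x + z)) ∧
    diffEntropy ((gaussianNoise N σ).map (fun z => x + z)) =
      (N : ℝ) / 2 * Real.logb 2 (2 * Real.pi * σ ^ 2)
        + (N : ℝ) / 2 * Real.logb 2 (Real.exp 1) := by
  have hpi := Real.pi_pos
  have hlog2 : 0 < Real.log 2 := Real.log_pos (by norm_num)
  have hd : (gaussianNoise N σ).map (fun z => x + z) =
      volume.withDensity (fun y => ENNReal.ofReal (gaussDensity N σ (y - x))) := by
    rw [gaussianNoise_eq_withDensity N hσ,
      map_add_left_withDensity (fun z => ENNReal.ofReal (gaussDensity N σ z))]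
  have hrn : (fun y => (((gaussianNoise N σ).map (fun z => x + z)).rnDeriv volume y).toReal *
      Real.logb 2 (((gaussianNoise N σ).map (fun z => x + z)).rnDeriv volume y).toReal) =ᵐ[volume]
      fun y => (fun z => gaussDensity N σ z * Real.logb 2 (gaussDensity N σ z)) (y - x) := by
    rw [hd]
    filter_upwards [Measure.rnDeriv_withDensity volume
      (f := fun y => ENNReal.ofReal (gaussDensity N σ (y - x))) (by fun_prop)] with y hy
    rw [hy, ENNReal.toReal_ofReal (gaussDensity_pos N hσ _).le]
  -- The logarithm is a constant minus a multiple of `‖z‖²`, so the entropy needs only the total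
  -- mass `1` and the second moment `N σ²`.
  have hval : (fun z => gaussDensity N σ z * Real.logb 2 (gaussDensity N σ z)) = fun z =>
      (-((N : ℝ) / 2) * Real.logb 2 (2 * Real.pi * σ ^ 2)) * gaussDensity N σ z
        - (1 / (2 * σ ^ 2 * Real.log 2)) * (gaussDensity N σ z * ‖z‖ ^ 2) := by
    ext z
    have : Real.logb 2 (gaussDensity N σ z) = -((N : ℝ) / 2) * Real.logb 2 (2 * Real.pi * σ ^ 2)
        - ‖z‖ ^ 2 / (2 * σ ^ 2 * Real.log 2) := by
      rw [gaussDensity, Real.logb_mul (by positivity) (by positivity),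
        Real.logb_rpow_eq_mul_logb_of_pos (by positivity)]
      rw [Real.logb, Real.logb, Real.log_exp]
      field_simp
      ring
    rw [this]
    ring
  have hi1 := integrable_gaussDensity N hσ
  have hI1 : ∫ z, gaussDensity N σ z = 1 := by
    have h := measure_univ (μ := gaussianNoise N σ)
    rw [gaussianNoise_eq_withDensity N hσ, withDensity_apply _ .univ, setLIntegral_univ] at h
    rw [integral_eq_lintegral_of_nonneg_ae (ae_of_all _ fun z => (gaussDensity_pos N hσ z).le)
      (by fun_prop), h]
    simp
  have hi2 : Integrable (fun z => gaussDensity N σ z * ‖z‖ ^ 2) := by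
    have h := (memLp_two_gaussianNoise N σ).integrable_norm_pow (by norm_num)
    rw [gaussianNoise_eq_withDensity N hσ,
      integrable_withDensity_iff_integrable_smul' (by fun_prop) (by simp)] at h
    refine h.congr (ae_of_all _ fun z => ?_)
    simp [ENNReal.toReal_ofReal (gaussDensity_pos N hσ _).le]
  have hI2 : ∫ z, gaussDensity N σ z * ‖z‖ ^ 2 = N * σ ^ 2 := by
    rw [← integral_norm_sq_gaussianNoise, gaussianNoise_eq_withDensity N hσ,
      integral_withDensity_eq_integral_toReal_smul (by fun_prop) (by simp)]
    refine integral_congr_ae (ae_of_all _ fun z => ?_)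
    simp [ENNReal.toReal_ofReal (gaussDensity_pos N hσ _).le]
  have hint : Integrable (fun z => gaussDensity N σ z * Real.logb 2 (gaussDensity N σ z)) := by
    rw [hval]
    exact (hi1.const_mul _).sub (hi2.const_mul _)
  refine ⟨⟨?_, ?_⟩, ?_⟩
  · rw [hd]; exact withDensity_absolutelyContinuous _ _
  · exact (integrable_congr hrn).2 (hint.comp_sub_right x)
  · rw [diffEntropy, integral_congr_ae hrn,
      integral_sub_right_eq_self (fun z => gaussDensity N σ z * Real.logb 2 (gaussDensity N σ z)) x,
      hval, integral_sub (hi1.const_mul _) (hi2.const_mul _), integral_const_mul,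
      integral_const_mul, hI1, hI2, Real.logb, Real.logb, Real.log_exp]
    field_simp
    ring

/-! ### Polar coordinates and one-dimensional Gaussian moments -/

/-- Polar coordinates for a product of an angular and a radial factor. The origin is a null set, so
`r > 0` suffices, and the product formula for integrals needs no integrability. -/
lemma integral_eq_toSphere_mul_integral_Ioi {E : Type*} [NormedAddCommGroup E] [NormedSpace ℝ E]
    [MeasurableSpace E] [BorelSpace E] [FiniteDimensional ℝ E] [Nontrivial E] (μ : Measure E)
    [μ.IsAddHaarMeasure] (h a : E → ℝ) (b : ℝ → ℝ)
    (hab : ∀ u : E, ‖u‖ = 1 → ∀ r : ℝ, 0 < r → h (r • u) = a u * b r) :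
    ∫ x, h x ∂μ = (∫ u, a u.1 ∂μ.toSphere) *
      ∫ r in Ioi (0 : ℝ), r ^ (Module.finrank ℝ E - 1) * b r :=
  calc
    ∫ x, h x ∂μ = ∫ x : ({(0)}ᶜ : Set E), h x.1 ∂(μ.comap (↑)) := by
      rw [integral_subtype_comap (measurableSet_singleton _).compl h, restrict_compl_singleton]
    _ = ∫ x, a x.1.1 * b x.2.1 ∂μ.toSphere.prod (.volumeIoiPow (Module.finrank ℝ E - 1)) := by
      rw [← μ.measurePreserving_homeomorphUnitSphereProd.integral_comp
        (Homeomorph.measurableEmbedding _)]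
      refine integral_congr_ae (ae_of_all _ fun x => ?_)
      have hx := hab (homeomorphUnitSphereProd E x).1.1 (norm_eq_of_mem_sphere _)
        (homeomorphUnitSphereProd E x).2.1 (homeomorphUnitSphereProd E x).2.2
      simp only
      rw [← hx]
      congr 1
      have hx0 : ‖x.1‖ ≠ 0 := norm_ne_zero_iff.2 x.2
      simp [smul_smul, hx0]
    _ = (∫ u, a u.1 ∂μ.toSphere) *
        ∫ x : Ioi (0 : ℝ), b x ∂.volumeIoiPow (Module.finrank ℝ E - 1) :=
      integral_prod_mul (fun u : Metric.sphere (0 : E) 1 => a u.1) (fun r : Ioi (0 : ℝ) => b r.1)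
    _ = _ := by
      congr 1
      simp only [Measure.volumeIoiPow, ENNReal.ofReal]
      rw [integral_withDensity_eq_integral_smul,
        integral_subtype_comap measurableSet_Ioi
          fun a ↦ Real.toNNReal (a ^ (Module.finrank ℝ E - 1)) • b a,
        setIntegral_congr_fun measurableSet_Ioi fun x hx ↦ ?_]
      · rw [NNReal.smul_def, Real.coe_toNNReal _ (pow_nonneg hx.out.le _), smul_eq_mul]
      · exact (measurable_subtype_coe.pow_const _).real_toNNReal

lemma integral_pow_mul_exp_neg_sq_div_two_Ioi (n : ℕ) :
    ∫ r in Ioi (0 : ℝ), r ^ n * Real.exp (-r ^ 2 / 2) =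
      2 ^ (((n : ℝ) - 1) / 2) * Real.Gamma (((n : ℝ) + 1) / 2) := by
  have hn : (0 : ℝ) ≤ n := n.cast_nonneg
  have h := integral_rpow_mul_exp_neg_mul_rpow (p := 2) (q := n) (b := 1 / 2) (by norm_num)
    (by linarith) (by norm_num)
  have e : ∀ r : ℝ, r ^ n * Real.exp (-r ^ 2 / 2)
      = r ^ (n : ℝ) * Real.exp (-(1 / 2) * r ^ (2 : ℝ)) := by
    intro r
    rw [Real.rpow_natCast, Real.rpow_two]
    ring_nf
  simp_rw [e]
  rw [h]
  congr 1
  rw [one_div, Real.inv_rpow (by norm_num), ← Real.rpow_neg (by norm_num),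
    ← Real.rpow_neg_one (2 : ℝ), ← Real.rpow_add (by norm_num)]
  congr 1
  ring

lemma integral_odd_pow_gaussianReal (n : ℕ) (hn : Odd n) :
    ∫ x, x ^ n ∂(gaussianReal 0 1) = 0 := by
  have h : ∫ x, x ^ n ∂(gaussianReal 0 1) = ∫ x, (-x) ^ n ∂(gaussianReal 0 1) := by
    conv_lhs => rw [show gaussianReal 0 1 = (gaussianReal 0 1).map (fun x => -x) by
      rw [gaussianReal_map_neg, neg_zero]]
    rw [integral_map (by fun_prop) (by fun_prop)]
  simp_rw [hn.neg_pow, integral_neg] at h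
  linarith

lemma integral_even_pow_gaussianReal (m : ℕ) :
    ∫ x, x ^ (2 * m) ∂(gaussianReal 0 1) = 2 ^ m * Real.Gamma (m + 1 / 2) / √Real.pi := by
  have hpi := Real.pi_pos
  rw [integral_gaussianReal_eq_integral_smul (by norm_num)]
  have e : ∀ x : ℝ, gaussianPDFReal 0 1 x • x ^ (2 * m) =
      (√(2 * Real.pi))⁻¹ * (fun t : ℝ => t ^ (2 * m) * Real.exp (-t ^ 2 / 2)) |x| := by
    intro x
    simp [gaussianPDFReal, (even_two_mul m).pow_abs]
    ring
  simp_rw [e]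
  rw [integral_const_mul,
    integral_comp_abs (f := fun t : ℝ => t ^ (2 * m) * Real.exp (-t ^ 2 / 2)),
    integral_pow_mul_exp_neg_sq_div_two_Ioi,
    Real.sqrt_mul (by norm_num)]
  push_cast
  rw [show ((2 * m : ℝ) - 1) / 2 = m + -(1 / 2) by ring, Real.rpow_add (by norm_num),
    Real.rpow_natCast, Real.rpow_neg (by norm_num), ← Real.sqrt_eq_rpow,
    show ((2 * m : ℝ) + 1) / 2 = m + 1 / 2 by ring]
  have h2 : (√2 : ℝ) * √2 = 2 := Real.mul_self_sqrt (by norm_num)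
  have : 0 < √Real.pi := Real.sqrt_pos.2 hpi
  field_simp
  nlinarith

/-- A form of the duplication formula; it turns the even terms of the exponential series into
Bessel-type terms. -/
lemma two_mul_factorial_eq_Gamma (m : ℕ) :
    ((2 * m).factorial : ℝ) * √Real.pi = 4 ^ m * m.factorial * Real.Gamma (m + 1 / 2) := by
  induction m with
  | zero => simp [Real.Gamma_one_half_eq, -one_div]
  | succ m ih =>
    rw [show 2 * (m + 1) = (2 * m + 1) + 1 by ring, Nat.factorial_succ, Nat.factorial_succ,
      Nat.factorial_succ]
    push_cast
    rw [show (m : ℝ) + 1 + 1 / 2 = (m + 1 / 2) + 1 by ring, Real.Gamma_add_one (by positivity)]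
    linear_combination ((2 * m + 1 + 1 : ℝ) * (2 * m + 1)) * ih

/-! ### Moments and Laplace transform of the uniform distribution on the sphere -/

section Sphere

variable {N : ℕ}

/-- Both sides equal the integral of `⟪v, x⟫ ^ n * exp(-‖x‖²/2)` over the whole space: polar
coordinates give the left side, and the right side uses that `⟪v, x⟫` is standard normal under the
standard Gaussian. The case `n = 0` yields the surface area. -/
lemma toSphere_inner_pow_mul (hN : 1 ≤ N) (v : EuclideanSpace ℝ (Fin N)) (hv : ‖v‖ = 1) (n : ℕ) :
    (∫ u, (inner ℝ v u.1) ^ n ∂(volume : Measure (EuclideanSpace ℝ (Fin N))).toSphere) *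
      (2 ^ (((n : ℝ) + N) / 2 - 1) * Real.Gamma (((n : ℝ) + N) / 2)) =
      (2 * Real.pi) ^ ((N : ℝ) / 2) * ∫ x, x ^ n ∂(gaussianReal 0 1) := by
  have hpi := Real.pi_pos
  have : Nontrivial (EuclideanSpace ℝ (Fin N)) :=
    Module.nontrivial_of_finrank_pos (R := ℝ) (by simpa [Nat.pos_iff_ne_zero, Nat.one_le_iff_ne_zero] using hN)
  have hp := integral_eq_toSphere_mul_integral_Ioi
    (volume : Measure (EuclideanSpace ℝ (Fin N)))
    (fun x => (inner ℝ v x) ^ n * Real.exp (-‖x‖ ^ 2 / 2)) (fun u => (inner ℝ v u) ^ n)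
    (fun r => r ^ n * Real.exp (-r ^ 2 / 2)) (by
      intro u hu r hr
      simp only [real_inner_smul_right, norm_smul, hu, Real.norm_eq_abs, abs_of_pos hr]
      rw [mul_pow]
      ring_nf)
  have e : ∀ r : ℝ, r ^ (N - 1) * (r ^ n * Real.exp (-r ^ 2 / 2))
      = r ^ (n + (N - 1)) * Real.exp (-r ^ 2 / 2) := fun r => by ring
  simp only [finrank_euclideanSpace, Fintype.card_fin, e] at hp
  rw [integral_pow_mul_exp_neg_sq_div_two_Ioi] at hp
  rw [show (((n + (N - 1) : ℕ) : ℝ) - 1) / 2 = ((n : ℝ) + N) / 2 - 1 by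
      push_cast [hN]; ring,
    show (((n + (N - 1) : ℕ) : ℝ) + 1) / 2 = ((n : ℝ) + N) / 2 by
      push_cast [hN]; ring] at hp
  rw [← hp, ← map_inner_stdGaussian v hv, integral_map (by fun_prop) (by fun_prop)]
  have hstd : stdGaussian (EuclideanSpace ℝ (Fin N)) = gaussianNoise N 1 := by
    simp [gaussianNoise]
  rw [hstd, gaussianNoise_eq_withDensity N one_pos,
    integral_withDensity_eq_integral_toReal_smul (by fun_prop) (by simp), ← integral_const_mul]
  refine integral_congr_ae (ae_of_all _ fun x => ?_)
  simp only
  rw [ENNReal.toReal_ofReal (gaussDensity_pos N one_pos _).le, gaussDensity, smul_eq_mul]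
  rw [Real.rpow_neg (by positivity)]
  have : 0 < (2 * Real.pi) ^ ((N : ℝ) / 2) := by positivity
  simp only [one_pow, mul_one]
  field_simp

/-- The surface area of the unit sphere in `ℝ^N`. -/
lemma toSphere_real_univ (hN : 1 ≤ N) :
    (volume : Measure (EuclideanSpace ℝ (Fin N))).toSphere.real univ =
      2 * Real.pi ^ ((N : ℝ) / 2) / Real.Gamma ((N : ℝ) / 2) := by
  have hpi := Real.pi_pos
  have hN' : (0 : ℝ) < N := by exact_mod_cast hN
  have hG : 0 < Real.Gamma ((N : ℝ) / 2) := Real.Gamma_pos_of_pos (by positivity)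
  have h := toSphere_inner_pow_mul hN (EuclideanSpace.single ⟨0, hN⟩ 1) (by simp) 0
  simp only [pow_zero, integral_const, smul_eq_mul, mul_one, Nat.cast_zero, zero_add,
    probReal_univ] at h
  rw [Real.rpow_sub (by norm_num), Real.mul_rpow (by norm_num) hpi.le, Real.rpow_one] at h
  have : (0 : ℝ) < 2 ^ ((N : ℝ) / 2) := by positivity
  field_simp at h ⊢
  linarith

/-- The normalized surface measure on the unit sphere. -/
noncomputable def unitSphereProb (N : ℕ) :
    Measure (Metric.sphere (0 : EuclideanSpace ℝ (Fin N)) 1) :=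
  ((volume : Measure (EuclideanSpace ℝ (Fin N))).toSphere univ)⁻¹ •
    (volume : Measure (EuclideanSpace ℝ (Fin N))).toSphere

lemma isProbabilityMeasure_unitSphereProb (hN : 1 ≤ N) :
    IsProbabilityMeasure (unitSphereProb N) := by
  have : Nontrivial (EuclideanSpace ℝ (Fin N)) :=
    Module.nontrivial_of_finrank_pos (R := ℝ) (by simpa [Nat.pos_iff_ne_zero, Nat.one_le_iff_ne_zero] using hN)
  constructor
  rw [unitSphereProb, Measure.smul_apply, smul_eq_mul]
  apply ENNReal.inv_mul_cancel
  · exact Measure.measure_univ_ne_zero.2 (Measure.toSphere_ne_zero _)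
  · exact measure_ne_top _ _

lemma integral_unitSphereProb (f : Metric.sphere (0 : EuclideanSpace ℝ (Fin N)) 1 → ℝ) :
    ∫ u, f u ∂(unitSphereProb N) =
      ((volume : Measure (EuclideanSpace ℝ (Fin N))).toSphere.real univ)⁻¹ *
        ∫ u, f u ∂(volume : Measure (EuclideanSpace ℝ (Fin N))).toSphere := by
  rw [unitSphereProb, integral_smul_measure, ENNReal.toReal_inv]
  rfl

lemma integral_inner_odd_pow_unitSphereProb (hN : 1 ≤ N) (v : EuclideanSpace ℝ (Fin N))
    (hv : ‖v‖ = 1) (n : ℕ) (hn : Odd n) : ∫ u, (inner ℝ v u.1) ^ n ∂(unitSphereProb N) = 0 := by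
  have hN' : (0 : ℝ) < N := by exact_mod_cast hN
  have h := toSphere_inner_pow_mul hN v hv n
  have hG : 0 < Real.Gamma (((n : ℝ) + N) / 2) := Real.Gamma_pos_of_pos (by positivity)
  rw [integral_odd_pow_gaussianReal n hn, mul_zero] at h
  rw [integral_unitSphereProb, (mul_eq_zero.1 h).resolve_right (by positivity), mul_zero]

lemma integral_inner_even_pow_unitSphereProb (hN : 1 ≤ N) (v : EuclideanSpace ℝ (Fin N))
    (hv : ‖v‖ = 1) (m : ℕ) : ∫ u, (inner ℝ v u.1) ^ (2 * m) ∂(unitSphereProb N) =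
      Real.Gamma (m + 1 / 2) * Real.Gamma ((N : ℝ) / 2)
        / (√Real.pi * Real.Gamma (m + (N : ℝ) / 2)) := by
  have hpi := Real.pi_pos
  have hN' : (0 : ℝ) < N := by exact_mod_cast hN
  have h := toSphere_inner_pow_mul hN v hv (2 * m)
  have e : (((2 * m : ℕ) : ℝ) + N) / 2 = m + (N : ℝ) / 2 := by push_cast; ring
  rw [e, integral_even_pow_gaussianReal, Real.mul_rpow (by norm_num) hpi.le, add_sub_assoc,
    Real.rpow_add (by norm_num), Real.rpow_natCast, Real.rpow_sub (by norm_num), Real.rpow_one] at h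
  have hG : 0 < Real.Gamma ((N : ℝ) / 2) := Real.Gamma_pos_of_pos (by positivity)
  have hG' : 0 < Real.Gamma (m + (N : ℝ) / 2) := Real.Gamma_pos_of_pos (by positivity)
  have : (0 : ℝ) < 2 ^ ((N : ℝ) / 2) := by positivity
  have : (0 : ℝ) < Real.pi ^ ((N : ℝ) / 2) := by positivity
  have : 0 < √Real.pi := Real.sqrt_pos.2 hpi
  rw [integral_unitSphereProb, toSphere_real_univ hN]
  field_simp at h ⊢
  linarith

/-- The exponential series may be integrated termwise because `|⟪v, u⟫| ≤ 1`. Odd moments vanish,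
and the even ones are ratios of Gamma values. -/
lemma hasSum_integral_exp_inner_unit (hN : 1 ≤ N) (v : EuclideanSpace ℝ (Fin N))
    (hv : ‖v‖ = 1) (t : ℝ) :
    HasSum (fun m : ℕ => Real.Gamma ((N : ℝ) / 2) *
      ((t ^ 2 / 4) ^ m / (m.factorial * Real.Gamma (m + (N : ℝ) / 2))))
      (∫ u, Real.exp (t * inner ℝ v u.1) ∂(unitSphereProb N)) := by
  have hpi := Real.pi_pos
  have := isProbabilityMeasure_unitSphereProb hN
  have hN' : (0 : ℝ) < N := by exact_mod_cast hN
  have hb : ∀ u : Metric.sphere (0 : EuclideanSpace ℝ (Fin N)) 1, |inner ℝ v u.1| ≤ 1 := by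
    intro u
    have := abs_real_inner_le_norm v u.1
    simpa [hv] using this
  have hbn : ∀ (n : ℕ) (u : Metric.sphere (0 : EuclideanSpace ℝ (Fin N)) 1),
      ‖(t * inner ℝ v u.1) ^ n / n.factorial‖ ≤ |t| ^ n / n.factorial := by
    intro n u
    rw [norm_div, norm_pow, norm_mul, Real.norm_eq_abs, Real.norm_eq_abs, Real.norm_natCast]
    gcongr
    exact mul_le_of_le_one_right (abs_nonneg _) (hb u)
  have hcont : ∀ n : ℕ, Continuous (fun u : Metric.sphere (0 : EuclideanSpace ℝ (Fin N)) 1 =>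
      (t * inner ℝ v u.1) ^ n / (n.factorial : ℝ)) := fun n => by fun_prop
  have hsum := hasSum_integral_of_summable_integral_norm (μ := unitSphereProb N)
    (F := fun (n : ℕ) u => (t * inner ℝ v u.1) ^ n / (n.factorial : ℝ))
    (fun n => Integrable.of_bound (hcont n).aestronglyMeasurable _ (ae_of_all _ (hbn n)))
    (by
      refine (Real.summable_pow_div_factorial |t|).of_nonneg_of_le
        (fun n => integral_nonneg fun u => norm_nonneg _) (fun n => ?_)
      calc _ ≤ ∫ _, |t| ^ n / n.factorial ∂(unitSphereProb N) := by
            refine integral_mono_of_nonneg (ae_of_all _ fun u => norm_nonneg _)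
              (integrable_const _) (ae_of_all _ (hbn n))
        _ = _ := by simp)
  have e : ∀ u : Metric.sphere (0 : EuclideanSpace ℝ (Fin N)) 1,
      ∑' n : ℕ, (t * inner ℝ v u.1) ^ n / (n.factorial : ℝ) = Real.exp (t * inner ℝ v u.1) := by
    intro u
    rw [Real.exp_eq_exp_ℝ, NormedSpace.exp_eq_tsum_div]
  simp_rw [e] at hsum
  have hf : ∀ n : ℕ, ∫ u : Metric.sphere (0 : EuclideanSpace ℝ (Fin N)) 1,
      (t * inner ℝ v u.1) ^ n / (n.factorial : ℝ) ∂(unitSphereProb N) =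
      t ^ n / n.factorial * ∫ u, (inner ℝ v u.1) ^ n ∂(unitSphereProb N) := by
    intro n
    rw [← integral_const_mul]
    congr 1
    ext u
    rw [mul_pow]
    ring
  simp_rw [hf] at hsum
  -- The sum is reindexed over even exponents; terms outside the range of `m ↦ 2 * m` are odd
  -- moments, hence zero.
  have hinj : Function.Injective (fun m : ℕ => 2 * m) := fun a b h => by simpa using h
  rw [← hinj.hasSum_iff] at hsum
  · refine hsum.congr_fun fun m => ?_
    simp only [Function.comp]
    rw [integral_inner_even_pow_unitSphereProb hN v hv m]
    have hfac := two_mul_factorial_eq_Gamma m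
    have h1 : 0 < Real.Gamma ((m : ℝ) + 1 / 2) := Real.Gamma_pos_of_pos (by positivity)
    have h2 : 0 < Real.Gamma (m + (N : ℝ) / 2) := Real.Gamma_pos_of_pos (by positivity)
    have h3 : 0 < √Real.pi := Real.sqrt_pos.2 hpi
    have h4 : (0 : ℝ) < m.factorial := by positivity
    have h5 : (0 : ℝ) < (2 * m).factorial := by positivity
    rw [div_pow, ← pow_mul]
    generalize Real.Gamma ((m : ℝ) + 1 / 2) = g at *
    field_simp
    linear_combination t ^ (2 * m) * hfac
  · intro n hn
    have : Odd n := by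
      rw [← Nat.not_even_iff_odd]
      rintro ⟨k, rfl⟩
      exact hn ⟨k, by ring⟩
    rw [integral_inner_odd_pow_unitSphereProb hN v hv n this, mul_zero]

/-- The moment generating function of the uniform distribution on the unit sphere. -/
lemma hasSum_integral_exp_inner (hN : 1 ≤ N) (w : EuclideanSpace ℝ (Fin N)) :
    HasSum (fun m : ℕ => Real.Gamma ((N : ℝ) / 2) *
      ((‖w‖ ^ 2 / 4) ^ m / (m.factorial * Real.Gamma (m + (N : ℝ) / 2))))
      (∫ u, Real.exp (inner ℝ w u.1) ∂(unitSphereProb N)) := by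
  obtain ⟨v, hv, hw⟩ : ∃ v : EuclideanSpace ℝ (Fin N), ‖v‖ = 1 ∧ w = ‖w‖ • v := by
    by_cases h : w = 0
    · exact ⟨EuclideanSpace.single ⟨0, hN⟩ 1, by simp, by simp [h]⟩
    · refine ⟨‖w‖⁻¹ • w, by simp [norm_smul, h], ?_⟩
      rw [smul_smul, mul_inv_cancel₀ (by simpa using h), one_smul]
  have := hasSum_integral_exp_inner_unit hN v hv ‖w‖
  convert this using 4 with u
  conv_lhs => rw [hw]
  rw [real_inner_smul_left]

end Sphere

/-! ### Bounds and measurability of the Laplace transform -/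

/-- The power series of `x ↦ 𝔼[exp (x ⟨v, U⟩)]` for `U` uniform on the unit sphere of `ℝ^N` and a
unit vector `v`. -/
noncomputable def sphereMGF (N : ℕ) (x : ℝ) : ℝ :=
  Real.Gamma ((N : ℝ) / 2) *
    ∑' m : ℕ, (x ^ 2 / 4) ^ m / (m.factorial * Real.Gamma (m + (N : ℝ) / 2))

section SphereMGF

variable {N : ℕ}

lemma integral_exp_inner_unitSphereProb (hN : 1 ≤ N) (w : EuclideanSpace ℝ (Fin N)) :
    ∫ u, Real.exp (inner ℝ w u.1) ∂(unitSphereProb N) = sphereMGF N ‖w‖ := by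
  rw [← (hasSum_integral_exp_inner hN w).tsum_eq, tsum_mul_left, sphereMGF]

lemma integrable_exp_inner_unitSphereProb (hN : 1 ≤ N) (w : EuclideanSpace ℝ (Fin N)) :
    Integrable (fun u => Real.exp (inner ℝ w u.1)) (unitSphereProb N) := by
  have := isProbabilityMeasure_unitSphereProb hN
  refine Integrable.of_bound (C := Real.exp ‖w‖) (by fun_prop) (ae_of_all _ fun u => ?_)
  rw [Real.norm_eq_abs, Real.abs_exp, Real.exp_le_exp]
  simpa using real_inner_le_norm w u.1

/-- By Cauchy–Schwarz the averaged exponent is at least `-x`; a vector of norm `x` along a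
coordinate axis realises the argument. -/
lemma exp_neg_le_sphereMGF (hN : 1 ≤ N) {x : ℝ} (hx : 0 ≤ x) :
    Real.exp (-x) ≤ sphereMGF N x := by
  have := isProbabilityMeasure_unitSphereProb hN
  set w : EuclideanSpace ℝ (Fin N) := EuclideanSpace.single ⟨0, hN⟩ x with hw
  have hwn : ‖w‖ = x := by simp [hw, abs_of_nonneg hx]
  have h := integral_mono (μ := unitSphereProb N) (integrable_const (Real.exp (-x)))
    (integrable_exp_inner_unitSphereProb hN w) (fun u => by
      have := (abs_le.1 (abs_real_inner_le_norm w u.1)).1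
      simp only [norm_eq_of_mem_sphere, mul_one, hwn] at this
      exact Real.exp_le_exp.2 this)
  rw [integral_exp_inner_unitSphereProb hN, hwn] at h
  simpa using h

lemma sphereMGF_le_exp (hN : 1 ≤ N) {x : ℝ} (hx : 0 ≤ x) : sphereMGF N x ≤ Real.exp x := by
  have := isProbabilityMeasure_unitSphereProb hN
  set w : EuclideanSpace ℝ (Fin N) := EuclideanSpace.single ⟨0, hN⟩ x with hw
  have hwn : ‖w‖ = x := by simp [hw, abs_of_nonneg hx]
  have h := integral_mono (μ := unitSphereProb N) (integrable_exp_inner_unitSphereProb hN w)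
    (integrable_const (Real.exp x)) (fun u => by
      have := real_inner_le_norm w u.1
      simp only [norm_eq_of_mem_sphere, mul_one, hwn] at this
      exact Real.exp_le_exp.2 this)
  rw [integral_exp_inner_unitSphereProb hN, hwn] at h
  simpa using h

lemma measurable_sphereMGF (hN : 1 ≤ N) : Measurable (sphereMGF N) := by
  refine measurable_of_tendsto_metrizable
    (f := fun (n : ℕ) (x : ℝ) => ∑ m ∈ Finset.range n, Real.Gamma ((N : ℝ) / 2) *
      ((x ^ 2 / 4) ^ m / (m.factorial * Real.Gamma (m + (N : ℝ) / 2)))) (fun n => by fun_prop) ?_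
  rw [tendsto_pi_nhds]
  intro x
  -- Negative `x` is covered too, since the series sees the norm of this vector only through its
  -- square `x²`.
  have h := hasSum_integral_exp_inner hN (EuclideanSpace.single ⟨0, hN⟩ x)
  have hn : ‖(EuclideanSpace.single ⟨0, hN⟩ x : EuclideanSpace ℝ (Fin N))‖ ^ 2 = x ^ 2 := by
    simp
  rw [hn] at h
  have e := h.tsum_eq
  rw [tsum_mul_left] at e
  rw [← e] at h
  exact h.tendsto_sum_nat

end SphereMGF

/-! ### The radial profile: bounds and link with the noncentral chi density -/

/-- The density of `‖Y‖ / σ` divided by the surface area of the sphere, up to a constant. -/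
noncomputable def radialProfile (N K : ℕ) (Δ r : ℝ) : ℝ :=
  (1 / (K : ℝ)) * ∑ k ∈ Finset.Icc 1 K,
    Real.exp (-(r ^ 2 + (k * Δ) ^ 2) / 2) * sphereMGF N (r * (k * Δ))

section RadialProfile

variable {N K : ℕ} {Δ : ℝ}

lemma measurable_radialProfile (hN : 1 ≤ N) : Measurable (radialProfile N K Δ) := by
  unfold radialProfile
  refine measurable_const.mul (Finset.measurable_sum _ fun k _ => ?_)
  exact (by fun_prop : Measurable fun r : ℝ => Real.exp (-(r ^ 2 + (k * Δ) ^ 2) / 2)).mul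
    ((measurable_sphereMGF hN).comp (by fun_prop))

/-- With `sphereMGF N x ≤ exp x`, completing the square bounds each term by `exp(-(r - kΔ)²/2) ≤ 1`.
-/
lemma radialProfile_le_one (hN : 1 ≤ N) (hK : 1 ≤ K) (hΔ : 0 < Δ) {r : ℝ} (hr : 0 ≤ r) :
    radialProfile N K Δ r ≤ 1 := by
  have hK' : (0 : ℝ) < K := by exact_mod_cast hK
  calc radialProfile N K Δ r ≤ (1 / (K : ℝ)) * ∑ k ∈ Finset.Icc 1 K, (1 : ℝ) := by
        unfold radialProfile
        gcongr with k hk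
        calc _ ≤ Real.exp (-(r ^ 2 + (k * Δ) ^ 2) / 2) * Real.exp (r * (k * Δ)) := by
              gcongr
              exact sphereMGF_le_exp hN (by positivity)
          _ ≤ 1 := by
              rw [← Real.exp_add, Real.exp_le_one_iff]
              nlinarith [sq_nonneg (r - k * Δ)]
    _ = 1 := by simp [hK'.ne']

/-- With `exp (-x) ≤ sphereMGF N x`, each term is at least `exp(-(r + kΔ)²/2)`, which is smallest at
`k = K`. -/
lemma exp_le_radialProfile (hN : 1 ≤ N) (hK : 1 ≤ K) (hΔ : 0 < Δ) {r : ℝ} (hr : 0 ≤ r) :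
    Real.exp (-(r + K * Δ) ^ 2 / 2) ≤ radialProfile N K Δ r := by
  have hK' : (0 : ℝ) < K := by exact_mod_cast hK
  calc Real.exp (-(r + K * Δ) ^ 2 / 2)
      = (1 / (K : ℝ)) * ∑ k ∈ Finset.Icc 1 K, Real.exp (-(r + K * Δ) ^ 2 / 2) := by
        simp; field_simp
    _ ≤ radialProfile N K Δ r := by
        unfold radialProfile
        gcongr with k hk
        have hk' : (k : ℝ) ≤ K := by exact_mod_cast (Finset.mem_Icc.1 hk).2
        calc Real.exp (-(r + K * Δ) ^ 2 / 2) ≤ Real.exp (-(r + k * Δ) ^ 2 / 2) := by gcongr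
          _ = Real.exp (-(r ^ 2 + (k * Δ) ^ 2) / 2) * Real.exp (-(r * (k * Δ))) := by
            rw [← Real.exp_add]; ring_nf
          _ ≤ _ := by
            gcongr
            exact exp_neg_le_sphereMGF hN (by positivity)

lemma radialProfile_pos (hN : 1 ≤ N) (hK : 1 ≤ K) (hΔ : 0 < Δ) {r : ℝ} (hr : 0 ≤ r) :
    0 < radialProfile N K Δ r :=
  (Real.exp_pos _).trans_le (exp_le_radialProfile hN hK hΔ hr)

/-- Quadratic growth of the logarithm lets a second moment dominate the entropy integrand. The
constant comes from `(r + KΔ)²/2 ≤ r² + (KΔ)²`. -/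
lemma abs_logb_radialProfile_le (hN : 1 ≤ N) (hK : 1 ≤ K) (hΔ : 0 < Δ) {r : ℝ} (hr : 0 ≤ r) :
    |Real.logb 2 (radialProfile N K Δ r)| ≤ (r ^ 2 + (K * Δ) ^ 2) / Real.log 2 := by
  have hlog2 : 0 < Real.log 2 := Real.log_pos (by norm_num)
  have h1 : Real.log (radialProfile N K Δ r) ≤ 0 :=
    Real.log_nonpos (radialProfile_pos hN hK hΔ hr).le (radialProfile_le_one hN hK hΔ hr)
  have h2 := Real.log_le_log (Real.exp_pos _) (exp_le_radialProfile hN hK hΔ hr)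
  rw [Real.log_exp] at h2
  rw [Real.logb, abs_div, abs_of_pos hlog2]
  gcongr
  rw [abs_of_nonpos h1]
  nlinarith [sq_nonneg (r - K * Δ)]

/-- The prefactor `(rs/2)^(N/2-1)` of the Bessel function cancels the power of `s` and completes
`r^(N/2)` to `r^(N-1)`; the remaining series is that of `sphereMGF`, up to `Γ(N/2)`. -/
lemma chiDensity_eq {r s : ℝ} (hN : 1 ≤ N) (hr : 0 < r) (hs : 0 < s) :
    chiDensity N r s = 2 ^ (1 - (N : ℝ) / 2) / Real.Gamma ((N : ℝ) / 2) * r ^ (N - 1) *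
      (Real.exp (-(r ^ 2 + s ^ 2) / 2) * sphereMGF N (r * s)) := by
  have hN' : (0 : ℝ) < N := by exact_mod_cast hN
  have hG : 0 < Real.Gamma ((N : ℝ) / 2) := Real.Gamma_pos_of_pos (by positivity)
  have e : ∀ m : ℕ, (m : ℝ) + ((N : ℝ) / 2 - 1) + 1 = m + (N : ℝ) / 2 := fun m => by ring
  simp only [chiDensity, besselI, sphereMGF, e]
  have e2 : r ^ ((N : ℝ) / 2) / s ^ ((N : ℝ) / 2 - 1) * (r * s / 2) ^ ((N : ℝ) / 2 - 1)
      = 2 ^ (1 - (N : ℝ) / 2) * r ^ (N - 1) := by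
    rw [Real.div_rpow (by positivity) (by norm_num), Real.mul_rpow hr.le hs.le,
      ← Real.rpow_natCast r (N - 1), Nat.cast_sub hN,
      show ((N : ℝ) - (1 : ℕ)) = (N : ℝ) / 2 + ((N : ℝ) / 2 - 1) by push_cast; ring,
      Real.rpow_add hr, show 1 - (N : ℝ) / 2 = -((N : ℝ) / 2 - 1) by ring,
      Real.rpow_neg (by norm_num)]
    have : 0 < s ^ ((N : ℝ) / 2 - 1) := by positivity
    have : (0 : ℝ) < 2 ^ ((N : ℝ) / 2 - 1) := by positivity
    field_simp
  rw [div_mul_eq_mul_div (2 ^ (1 - (N : ℝ) / 2)), ← e2]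
  field_simp

lemma uniformRadialDensity_eq {r : ℝ} (hN : 1 ≤ N) (hΔ : 0 < Δ) (hr : 0 < r) :
    uniformRadialDensity N K Δ r = 2 ^ (1 - (N : ℝ) / 2) / Real.Gamma ((N : ℝ) / 2) *
      r ^ (N - 1) * radialProfile N K Δ r := by
  rw [uniformRadialDensity, radialProfile, mul_left_comm]
  congr 1
  rw [Finset.mul_sum]
  refine Finset.sum_congr rfl fun k hk => ?_
  have : (0 : ℝ) < k := by exact_mod_cast (Finset.mem_Icc.1 hk).1
  rw [chiDensity_eq hN hr (by positivity)]

end RadialProfile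

/-! ### The multisphere input and the averaged Gaussian density -/

section Multisphere

variable {N : ℕ}

lemma sphereUniform_eq_map (N : ℕ) (s : ℝ) : sphereUniform N s =
    (unitSphereProb N).map (fun u => s • u.1) := rfl

lemma isProbabilityMeasure_sphereUniform (hN : 1 ≤ N) (s : ℝ) :
    IsProbabilityMeasure (sphereUniform N s) := by
  have := isProbabilityMeasure_unitSphereProb hN
  rw [sphereUniform_eq_map]
  exact Measure.isProbabilityMeasure_map (by fun_prop)

lemma ae_norm_sphereUniform (N : ℕ) (s : ℝ) : ∀ᵐ x ∂(sphereUniform N s), ‖x‖ = |s| := by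
  rw [sphereUniform_eq_map, ae_map_iff (by fun_prop)
    (measurableSet_eq_fun (by fun_prop) (by fun_prop))]
  exact ae_of_all _ fun u => by simp [norm_smul]

lemma integral_norm_sq_sphereUniform (hN : 1 ≤ N) (s : ℝ) :
    ∫ x, ‖x‖ ^ 2 ∂(sphereUniform N s) = s ^ 2 := by
  have := isProbabilityMeasure_sphereUniform hN s
  rw [integral_congr_ae (g := fun _ => s ^ 2)
    ((ae_norm_sphereUniform N s).mono fun x hx => by simp only [hx, sq_abs])]
  simp

lemma ae_norm_le_multisphere (N K : ℕ) (p : ℕ → ℝ≥0∞) (s : ℕ → ℝ) (R : ℝ)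
    (hR : ∀ k ∈ Finset.Icc 1 K, |s k| ≤ R) : ∀ᵐ x ∂(multisphere N K p s), ‖x‖ ≤ R := by
  rw [multisphere, ae_finsetSum_measure_iff]
  intro k hk
  refine Measure.ae_smul_measure ?_ _
  filter_upwards [ae_norm_sphereUniform N (s k)] with x hx
  rw [hx]
  exact hR k hk

lemma integral_norm_sq_multisphere (hN : 1 ≤ N) (K : ℕ) (p : ℕ → ℝ≥0∞)
    (hp : ∀ k ∈ Finset.Icc 1 K, p k ≠ ∞) (s : ℕ → ℝ) :
    ∫ x, ‖x‖ ^ 2 ∂(multisphere N K p s) = ∑ k ∈ Finset.Icc 1 K, (p k).toReal * s k ^ 2 := by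
  rw [multisphere, integral_finsetSum_measure]
  · refine Finset.sum_congr rfl fun k _ => ?_
    rw [integral_smul_measure, integral_norm_sq_sphereUniform hN, smul_eq_mul]
  · intro k hk
    have := isProbabilityMeasure_sphereUniform hN (s k)
    refine Integrable.smul_measure ?_ (hp k hk)
    refine Integrable.of_bound (C := s k ^ 2) (by fun_prop) ?_
    filter_upwards [ae_norm_sphereUniform N (s k)] with x hx
    simp [hx]

/-- In `‖y - s u‖² = ‖y‖² - 2s⟪y, u⟫ + s²` only the cross term depends on `u`, so averaging gives
the Laplace transform at `(s/σ²) y`. -/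
lemma lintegral_gaussDensity_sphereUniform (hN : 1 ≤ N) {σ s : ℝ} (hσ : 0 < σ) (hs : 0 ≤ s)
    (y : EuclideanSpace ℝ (Fin N)) :
    ∫⁻ x, ENNReal.ofReal (gaussDensity N σ (y - x)) ∂(sphereUniform N s) =
      ENNReal.ofReal ((2 * Real.pi * σ ^ 2) ^ (-((N : ℝ) / 2)) *
        (Real.exp (-((‖y‖ / σ) ^ 2 + (s / σ) ^ 2) / 2) * sphereMGF N (‖y‖ / σ * (s / σ)))) := by
  have := isProbabilityMeasure_unitSphereProb hN
  rw [sphereUniform_eq_map, lintegral_map (by fun_prop) (by fun_prop)]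
  have e : ∀ u : Metric.sphere (0 : EuclideanSpace ℝ (Fin N)) 1,
      gaussDensity N σ (y - s • u.1) = (2 * Real.pi * σ ^ 2) ^ (-((N : ℝ) / 2)) *
        (Real.exp (-((‖y‖ / σ) ^ 2 + (s / σ) ^ 2) / 2) *
          Real.exp (inner ℝ ((s / σ ^ 2) • y) u.1)) := by
    intro u
    rw [gaussDensity, ← Real.exp_add, norm_sub_sq_real, real_inner_smul_left,
      real_inner_smul_right, norm_smul, norm_eq_of_mem_sphere, Real.norm_eq_abs, mul_one, sq_abs]
    congr 2
    field_simp
    ring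
  rw [← ofReal_integral_eq_lintegral_ofReal]
  · simp_rw [e]
    rw [integral_const_mul, integral_const_mul, integral_exp_inner_unitSphereProb hN, norm_smul,
      Real.norm_eq_abs, abs_of_nonneg (by positivity),
      show s / σ ^ 2 * ‖y‖ = ‖y‖ / σ * (s / σ) by field_simp]
  · simp_rw [e]
    exact ((integrable_exp_inner_unitSphereProb hN _).const_mul _).const_mul _
  · exact ae_of_all _ fun u => (gaussDensity_pos N hσ _).le

lemma lintegral_gaussDensity_multisphere (hN : 1 ≤ N) {K : ℕ} (hK : 1 ≤ K) {σ Δ : ℝ} (hσ : 0 < σ)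
    (hΔ : 0 < Δ) (y : EuclideanSpace ℝ (Fin N)) :
    ∫⁻ x, ENNReal.ofReal (gaussDensity N σ (y - x))
        ∂(multisphere N K (fun _ => (K : ℝ≥0∞)⁻¹) (fun k => k * σ * Δ)) =
      ENNReal.ofReal ((2 * Real.pi * σ ^ 2) ^ (-((N : ℝ) / 2)) *
        radialProfile N K Δ (‖y‖ / σ)) := by
  have hpi := Real.pi_pos
  have hK' : (0 : ℝ) < K := by exact_mod_cast hK
  rw [multisphere, lintegral_finsetSum_measure, radialProfile, mul_left_comm, Finset.mul_sum,
    ENNReal.ofReal_mul (by positivity), ENNReal.ofReal_sum_of_nonneg, Finset.mul_sum]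
  · refine Finset.sum_congr rfl fun k _ => ?_
    rw [lintegral_smul_measure, lintegral_gaussDensity_sphereUniform hN hσ (by positivity),
      one_div, ENNReal.ofReal_inv_of_pos hK', ENNReal.ofReal_natCast,
      show (k : ℝ) * σ * Δ / σ = k * Δ by field_simp]
    rfl
  · intro k _
    have := (Real.exp_pos _).le.trans
      (exp_neg_le_sphereMGF hN (x := ‖y‖ / σ * (k * Δ)) (by positivity))
    positivity

end Multisphere

/-! ### The Gaussian channel: conditional law, output law, conditional entropy -/

/-- The channel that adds Gaussian noise to its input. -/
noncomputable def gaussianChannel (N : ℕ) (σ : ℝ) :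
    Kernel (EuclideanSpace ℝ (Fin N)) (EuclideanSpace ℝ (Fin N)) :=
  (Kernel.id ×ₖ Kernel.const _ (gaussianNoise N σ)).map (fun p => p.1 + p.2)

instance isMarkovKernel_gaussianChannel (N : ℕ) (σ : ℝ) : IsMarkovKernel (gaussianChannel N σ) :=
  Kernel.IsMarkovKernel.map _ (by fun_prop)

lemma gaussianChannel_apply (N : ℕ) (σ : ℝ) (x : EuclideanSpace ℝ (Fin N)) :
    gaussianChannel N σ x = (gaussianNoise N σ).map (fun z => x + z) := by
  rw [gaussianChannel, Kernel.map_apply _ (by fun_prop), Kernel.prod_apply, Kernel.id_apply,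
    Kernel.const_apply, Measure.dirac_prod, Measure.map_map (by fun_prop) (by fun_prop)]
  rfl

section Channel

variable {N : ℕ} {σ : ℝ} {Ω : Type*} [MeasurableSpace Ω] {P : Measure Ω} [IsProbabilityMeasure P]
  {X Z : Ω → EuclideanSpace ℝ (Fin N)}

lemma map_add_eq_map_prod (hX : AEMeasurable X P) (hZ : HasLaw Z (gaussianNoise N σ) P)
    (hXZ : IndepFun X Z P) :
    P.map (fun ω => (X ω, X ω + Z ω)) =
      ((P.map X).prod (gaussianNoise N σ)).map (fun p => (p.1, p.1 + p.2)) := by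
  rw [← hZ.map_eq, ← hXZ.map_prod_eq_prod_map_map hX hZ.aemeasurable,
    AEMeasurable.map_map_of_aemeasurable (by fun_prop) (hX.prodMk hZ.aemeasurable)]
  rfl

/-- By independence the joint law of input and output is the law of `X` composed with the channel,
and disintegrations are almost everywhere unique. -/
lemma condDistrib_add_gaussianNoise (hX : AEMeasurable X P)
    (hZ : HasLaw Z (gaussianNoise N σ) P) (hXZ : IndepFun X Z P) :
    condDistrib (fun ω => X ω + Z ω) X P =ᵐ[P.map X] gaussianChannel N σ := by
  have := Measure.isProbabilityMeasure_map hX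
  refine condDistrib_ae_eq_of_measure_eq_compProd X (hX.fun_add hZ.aemeasurable) ?_
  rw [map_add_eq_map_prod hX hZ hXZ]
  refine Measure.ext_of_lintegral _ fun f hf => ?_
  rw [lintegral_map hf (by fun_prop), lintegral_prod _ (by fun_prop),
    Measure.lintegral_compProd hf]
  refine lintegral_congr fun x => ?_
  rw [gaussianChannel_apply, lintegral_map (by fun_prop) (by fun_prop)]

/-- The output law is a convolution, so by Tonelli it has a density even if the law of `X` is
singular. -/
lemma map_add_gaussianNoise_eq_withDensity (hσ : 0 < σ) (hX : AEMeasurable X P)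
    (hZ : HasLaw Z (gaussianNoise N σ) P) (hXZ : IndepFun X Z P) :
    P.map (fun ω => X ω + Z ω) = volume.withDensity
      (fun y => ∫⁻ x, ENNReal.ofReal (gaussDensity N σ (y - x)) ∂(P.map X)) := by
  have := Measure.isProbabilityMeasure_map hX
  have h : P.map (fun ω => X ω + Z ω) = (P.map (fun ω => (X ω, X ω + Z ω))).map Prod.snd := by
    rw [AEMeasurable.map_map_of_aemeasurable (by fun_prop)
      (hX.prodMk (hX.fun_add hZ.aemeasurable))]
    rfl
  rw [h, map_add_eq_map_prod hX hZ hXZ, Measure.map_map (by fun_prop) (by fun_prop)]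
  ext s hs
  rw [withDensity_apply _ hs, lintegral_lintegral_swap (by fun_prop),
    Measure.map_apply (by fun_prop) hs, Measure.prod_apply (by
      exact (by fun_prop : Measurable (Prod.snd ∘ fun p : EuclideanSpace ℝ (Fin N) ×
        EuclideanSpace ℝ (Fin N) => (p.1, p.1 + p.2))) hs)]
  refine lintegral_congr fun x => ?_
  rw [← withDensity_apply (fun y => ENNReal.ofReal (gaussDensity N σ (y - x))) hs,
    ← map_add_left_withDensity (fun z => ENNReal.ofReal (gaussDensity N σ z)),
    ← gaussianNoise_eq_withDensity N hσ, Measure.map_apply (by fun_prop) hs]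
  rfl

/-- Differential entropy is translation invariant, so the averaged function is almost everywhere
constant. -/
lemma condDiffEntropy_add_gaussianNoise (hσ : 0 < σ) (hX : AEMeasurable X P)
    (hZ : HasLaw Z (gaussianNoise N σ) P) (hXZ : IndepFun X Z P) :
    (∀ᵐ x ∂(P.map X), HasDiffEntropy (condDistrib (fun ω => X ω + Z ω) X P x)) ∧
    Integrable (fun x => diffEntropy (condDistrib (fun ω => X ω + Z ω) X P x)) (P.map X) ∧
    condDiffEntropy (fun ω => X ω + Z ω) X P =
      (N : ℝ) / 2 * Real.logb 2 (2 * Real.pi * σ ^ 2)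
        + (N : ℝ) / 2 * Real.logb 2 (Real.exp 1) := by
  have := Measure.isProbabilityMeasure_map hX
  have hc := condDistrib_add_gaussianNoise hX hZ hXZ
  have he : (fun x => diffEntropy (condDistrib (fun ω => X ω + Z ω) X P x)) =ᵐ[P.map X]
      fun _ => (N : ℝ) / 2 * Real.logb 2 (2 * Real.pi * σ ^ 2)
        + (N : ℝ) / 2 * Real.logb 2 (Real.exp 1) := by
    filter_upwards [hc] with x hx
    rw [hx, gaussianChannel_apply, (gaussianNoise_entropy N hσ x).2]
  refine ⟨?_, (integrable_congr he).2 (integrable_const _), ?_⟩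
  · filter_upwards [hc] with x hx
    rw [hx, gaussianChannel_apply]
    exact (gaussianNoise_entropy N hσ x).1
  · rw [condDiffEntropy, integral_congr_ae he]
    simp

end Channel

/-! ### Output density and its radial integrals -/

/-- The density of the channel output for the uniform multisphere input. -/
noncomputable def outputDensity (N K : ℕ) (σ Δ : ℝ) (y : EuclideanSpace ℝ (Fin N)) : ℝ :=
  (2 * Real.pi * σ ^ 2) ^ (-((N : ℝ) / 2)) * radialProfile N K Δ (‖y‖ / σ)

section OutputDensity

variable {N K : ℕ} {σ Δ : ℝ}

lemma outputDensity_pos (hN : 1 ≤ N) (hK : 1 ≤ K) (hσ : 0 < σ) (hΔ : 0 < Δ)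
    (y : EuclideanSpace ℝ (Fin N)) : 0 < outputDensity N K σ Δ y := by
  have hpi := Real.pi_pos
  have := radialProfile_pos (r := ‖y‖ / σ) hN hK hΔ (by positivity)
  unfold outputDensity
  positivity

lemma measurable_outputDensity (hN : 1 ≤ N) : Measurable (outputDensity N K σ Δ) :=
  measurable_const.mul ((measurable_radialProfile hN).comp (by fun_prop))

/-- The polar integrand of `h(‖y‖/σ) f_Y(y)` after the substitution `ρ = σ r`, shared by the
integral identity and the integrability criterion. -/
lemma radial_change_of_variables (hN : 1 ≤ N) (hσ : 0 < σ) (hΔ : 0 < Δ) (h : ℝ → ℝ) :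
    EqOn (fun r => (σ * r) ^ (N - 1) • (h (σ * r / σ) * ((2 * Real.pi * σ ^ 2) ^ (-((N : ℝ) / 2)) *
      radialProfile N K Δ (σ * r / σ))))
    (fun r => ((volume : Measure (EuclideanSpace ℝ (Fin N))).toSphere.real univ * σ)⁻¹ *
      (h r * uniformRadialDensity N K Δ r)) (Ioi 0) := by
  intro r (hr : 0 < r)
  beta_reduce
  have hpi := Real.pi_pos
  have hN' : (0 : ℝ) < N := by exact_mod_cast hN
  have hG : 0 < Real.Gamma ((N : ℝ) / 2) := Real.Gamma_pos_of_pos (by positivity)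
  rw [uniformRadialDensity_eq hN hΔ hr, toSphere_real_univ hN, mul_div_cancel_left₀ _ hσ.ne',
    mul_pow, smul_eq_mul, Real.rpow_neg (by positivity), Real.mul_rpow (by positivity)
    (by positivity), Real.mul_rpow (by norm_num) hpi.le, Real.rpow_sub (by norm_num), Real.rpow_one,
    ← Real.rpow_natCast σ 2, ← Real.rpow_mul hσ.le,
    -- Writing `(σ²)^(N/2)` as `σ^(N-1) * σ` makes the Jacobian factor `σ^(N-1)` cancel and leaves
    -- one `σ⁻¹`.
    show ((2 : ℕ) : ℝ) * ((N : ℝ) / 2) = ((N - 1 + 1 : ℕ) : ℝ) by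
      rw [Nat.sub_add_cancel hN]; push_cast; ring, Real.rpow_natCast, pow_succ]
  have : (0 : ℝ) < 2 ^ ((N : ℝ) / 2) := by positivity
  have : (0 : ℝ) < Real.pi ^ ((N : ℝ) / 2) := by positivity
  field_simp

/-- Averaging a function of `‖Y‖ / σ` amounts to integrating against the radial density. -/
lemma integral_radial_mul_outputDensity (hN : 1 ≤ N) (hσ : 0 < σ) (hΔ : 0 < Δ) (h : ℝ → ℝ) :
    ∫ y, h (‖y‖ / σ) * outputDensity N K σ Δ y =
      ∫ r in Ioi (0 : ℝ), h r * uniformRadialDensity N K Δ r := by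
  have : Nontrivial (EuclideanSpace ℝ (Fin N)) :=
    Module.nontrivial_of_finrank_pos (R := ℝ) (by
      simpa [Nat.pos_iff_ne_zero, Nat.one_le_iff_ne_zero] using hN)
  have hS : (volume : Measure (EuclideanSpace ℝ (Fin N))).toSphere.real univ ≠ 0 :=
    (measureReal_ne_zero_iff (measure_ne_top _ _)).2
      (Measure.measure_univ_ne_zero.2 (Measure.toSphere_ne_zero _))
  have h1 := integral_fun_norm_addHaar (volume : Measure (EuclideanSpace ℝ (Fin N)))
    (fun ρ => h (ρ / σ) * ((2 * Real.pi * σ ^ 2) ^ (-((N : ℝ) / 2)) * radialProfile N K Δ (ρ / σ)))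
  have h2 := integral_comp_mul_left_Ioi' (fun ρ : ℝ => ρ ^ (N - 1) • (h (ρ / σ) *
    ((2 * Real.pi * σ ^ 2) ^ (-((N : ℝ) / 2)) * radialProfile N K Δ (ρ / σ)))) 0 hσ
  rw [mul_zero] at h2
  rw [setIntegral_congr_fun measurableSet_Ioi
    (radial_change_of_variables (K := K) hN hσ hΔ h), integral_const_mul] at h2
  simp only [finrank_euclideanSpace, Fintype.card_fin] at h1
  rw [← h2] at h1
  simp only [outputDensity]
  rw [h1, ← smul_assoc, nsmul_eq_mul]
  have hS' := (volume : Measure (EuclideanSpace ℝ (Fin N))).toSphere_real_apply_univ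
  simp only [finrank_euclideanSpace, Fintype.card_fin] at hS'
  rw [← hS', smul_eq_mul, smul_eq_mul]
  field_simp

lemma integrable_radial_mul_outputDensity_iff (hN : 1 ≤ N) (hσ : 0 < σ) (hΔ : 0 < Δ)
    (h : ℝ → ℝ) :
    Integrable (fun y => h (‖y‖ / σ) * outputDensity N K σ Δ y) ↔
      IntegrableOn (fun r => h r * uniformRadialDensity N K Δ r) (Ioi 0) := by
  have : Nontrivial (EuclideanSpace ℝ (Fin N)) :=
    Module.nontrivial_of_finrank_pos (R := ℝ) (by
      simpa [Nat.pos_iff_ne_zero, Nat.one_le_iff_ne_zero] using hN)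
  have hS : (volume : Measure (EuclideanSpace ℝ (Fin N))).toSphere.real univ ≠ 0 :=
    (measureReal_ne_zero_iff (measure_ne_top _ _)).2
      (Measure.measure_univ_ne_zero.2 (Measure.toSphere_ne_zero _))
  have h1 := integrable_fun_norm_addHaar (volume : Measure (EuclideanSpace ℝ (Fin N)))
    (f := fun ρ => h (ρ / σ) *
      ((2 * Real.pi * σ ^ 2) ^ (-((N : ℝ) / 2)) * radialProfile N K Δ (ρ / σ)))
  have h2 := integrableOn_Ioi_comp_mul_left_iff (fun ρ : ℝ => ρ ^ (N - 1) • (h (ρ / σ) *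
    ((2 * Real.pi * σ ^ 2) ^ (-((N : ℝ) / 2)) * radialProfile N K Δ (ρ / σ)))) 0 hσ
  rw [mul_zero] at h2
  rw [integrableOn_congr_fun
    (radial_change_of_variables (K := K) hN hσ hΔ h) measurableSet_Ioi] at h2
  simp only [finrank_euclideanSpace, Fintype.card_fin] at h1
  simp only [outputDensity]
  rw [h1, ← h2]
  exact integrable_const_mul_iff (isUnit_iff_ne_zero.2 (inv_ne_zero (mul_ne_zero hS hσ.ne'))) _

end OutputDensity

/-! ### Sum of squares; generalities on measures with a density -/

lemma sum_Icc_sq (K : ℕ) :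
    ∑ k ∈ Finset.Icc 1 K, (k : ℝ) ^ 2 = K * (K + 1) * (2 * K + 1) / 6 := by
  induction K with
  | zero => simp
  | succ n ih =>
    rw [Finset.sum_Icc_succ_top (by omega), ih]
    push_cast
    ring

section WithDensity

variable {N : ℕ} {f : EuclideanSpace ℝ (Fin N) → ℝ}

lemma integrable_of_isFiniteMeasure_withDensity (hf : Measurable f) (h0 : ∀ y, 0 ≤ f y)
    [IsFiniteMeasure (volume.withDensity fun y => ENNReal.ofReal (f y))] : Integrable f := by
  refine ⟨hf.aestronglyMeasurable, ?_⟩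
  rw [hasFiniteIntegral_iff_ofReal (ae_of_all _ h0), ← setLIntegral_univ,
    ← withDensity_apply _ .univ]
  exact measure_lt_top _ _

lemma integral_eq_one_of_isProbabilityMeasure_withDensity (hf : Measurable f) (h0 : ∀ y, 0 ≤ f y)
    [IsProbabilityMeasure (volume.withDensity fun y => ENNReal.ofReal (f y))] :
    ∫ y, f y = 1 := by
  rw [integral_eq_lintegral_of_nonneg_ae (ae_of_all _ h0) hf.aestronglyMeasurable,
    ← setLIntegral_univ, ← withDensity_apply _ .univ, measure_univ, ENNReal.toReal_one]

lemma rnDeriv_mul_logb_ae_eq (hf : Measurable f) (h0 : ∀ y, 0 ≤ f y) :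
    (fun y => ((volume.withDensity fun y => ENNReal.ofReal (f y)).rnDeriv volume y).toReal *
      Real.logb 2 ((volume.withDensity fun y => ENNReal.ofReal (f y)).rnDeriv volume y).toReal)
      =ᵐ[volume] fun y => f y * Real.logb 2 (f y) := by
  filter_upwards [Measure.rnDeriv_withDensity volume hf.ennreal_ofReal] with y hy
  rw [hy, ENNReal.toReal_ofReal (h0 y)]

end WithDensity

/-! ### Law of the normalized envelope and entropy of the output -/

section Output

variable {N K : ℕ} {σ Δ : ℝ}

/-- The law of the normalized envelope of the output. -/
lemma map_norm_div_withDensity_outputDensity (hN : 1 ≤ N) (hK : 1 ≤ K) (hσ : 0 < σ) (hΔ : 0 < Δ)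
    (hf : Integrable (outputDensity N K σ Δ)) :
    (volume.withDensity fun y => ENNReal.ofReal (outputDensity N K σ Δ y)).map
        (fun y => ‖y‖ / σ) =
      (volume.restrict (Ioi (0 : ℝ))).withDensity
        (fun r => ENNReal.ofReal (uniformRadialDensity N K Δ r)) := by
  have hrad := (integrable_radial_mul_outputDensity_iff (N := N) (K := K) hN hσ hΔ
    (fun _ => 1)).1 (by simpa using hf)
  simp only [one_mul] at hrad
  have hnn : ∀ r ∈ Ioi (0 : ℝ), 0 ≤ uniformRadialDensity N K Δ r := by
    intro r (hr : 0 < r)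
    have hG : 0 < Real.Gamma ((N : ℝ) / 2) := Real.Gamma_pos_of_pos (by positivity)
    have := radialProfile_pos hN hK hΔ hr.le
    rw [uniformRadialDensity_eq hN hΔ hr]
    positivity
  ext s hs
  have hpre : MeasurableSet ((fun y : EuclideanSpace ℝ (Fin N) => ‖y‖ / σ) ⁻¹' s) :=
    (by fun_prop : Measurable fun y : EuclideanSpace ℝ (Fin N) => ‖y‖ / σ) hs
  rw [Measure.map_apply (by fun_prop) hs, withDensity_apply _ hpre, withDensity_apply _ hs,
    ← ofReal_integral_eq_lintegral_ofReal hf.integrableOn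
      (ae_of_all _ fun y => (outputDensity_pos hN hK hσ hΔ y).le),
    ← ofReal_integral_eq_lintegral_ofReal (Integrable.restrict hrad)
      (ae_restrict_of_ae (ae_restrict_of_forall_mem measurableSet_Ioi hnn)),
    ← integral_indicator hpre, ← integral_indicator hs]
  -- Testing the radial integration formula on the indicator of `s` compares the two measures on
  -- `s`.
  have h := integral_radial_mul_outputDensity (N := N) (K := K) hN hσ hΔ (s.indicator fun _ => 1)
  refine congrArg ENNReal.ofReal (Eq.trans ?_ (h.trans ?_))
  · refine integral_congr_ae (ae_of_all _ fun y => ?_)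
    by_cases hy : ‖y‖ / σ ∈ s <;> simp [indicator, hy]
  · refine integral_congr_ae (ae_of_all _ fun r => ?_)
    by_cases hr : r ∈ s <;> simp [hr]

/-- The differential entropy of the output in terms of the radial density. -/
lemma outputDensity_entropy (hN : 1 ≤ N) (hK : 1 ≤ K) (hσ : 0 < σ) (hΔ : 0 < Δ)
    (hf : Integrable (outputDensity N K σ Δ)) (hf1 : ∫ y, outputDensity N K σ Δ y = 1)
    (hf2 : Integrable (fun y => ‖y‖ ^ 2 * outputDensity N K σ Δ y)) :
    Integrable (fun y => outputDensity N K σ Δ y * Real.logb 2 (outputDensity N K σ Δ y)) ∧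
    IntegrableOn (fun r : ℝ => uniformRadialDensity N K Δ r *
      Real.logb 2 (uniformRadialDensity N K Δ r / r ^ (N - 1))) (Ioi 0) ∧
    -(∫ y, outputDensity N K σ Δ y * Real.logb 2 (outputDensity N K σ Δ y)) =
      -(∫ r in Ioi (0 : ℝ), uniformRadialDensity N K Δ r *
          Real.logb 2 (uniformRadialDensity N K Δ r / r ^ (N - 1)))
        + (1 - (N : ℝ) / 2 - Real.logb 2 (Real.Gamma ((N : ℝ) / 2)))
        + (N : ℝ) / 2 * Real.logb 2 (2 * Real.pi * σ ^ 2) := by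
  have hpi := Real.pi_pos
  have hN' : (0 : ℝ) < N := by exact_mod_cast hN
  have hG : 0 < Real.Gamma ((N : ℝ) / 2) := Real.Gamma_pos_of_pos (by positivity)
  have hlog2 : 0 < Real.log 2 := Real.log_pos (by norm_num)
  set h : ℝ → ℝ := fun r => Real.logb 2 (radialProfile N K Δ r) with hh
  have hy : (fun y => outputDensity N K σ Δ y * Real.logb 2 (outputDensity N K σ Δ y)) =
      fun y => -((N : ℝ) / 2) * Real.logb 2 (2 * Real.pi * σ ^ 2) * outputDensity N K σ Δ y
        + h (‖y‖ / σ) * outputDensity N K σ Δ y := by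
    ext y
    have hp := radialProfile_pos (r := ‖y‖ / σ) hN hK hΔ (by positivity)
    have : Real.logb 2 (outputDensity N K σ Δ y) =
        -((N : ℝ) / 2) * Real.logb 2 (2 * Real.pi * σ ^ 2) + h (‖y‖ / σ) := by
      rw [outputDensity, Real.logb_mul (by positivity) hp.ne',
        Real.logb_rpow_eq_mul_logb_of_pos (by positivity)]
    rw [this]
    ring
  have hr : EqOn (fun r : ℝ => uniformRadialDensity N K Δ r *
      Real.logb 2 (uniformRadialDensity N K Δ r / r ^ (N - 1)))
      (fun r => (1 - (N : ℝ) / 2 - Real.logb 2 (Real.Gamma ((N : ℝ) / 2))) *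
        uniformRadialDensity N K Δ r + h r * uniformRadialDensity N K Δ r) (Ioi 0) := by
    intro r (hr : 0 < r)
    have hp := radialProfile_pos hN hK hΔ hr.le
    have hrp : 0 < r ^ (N - 1) := by positivity
    have : Real.logb 2 (uniformRadialDensity N K Δ r / r ^ (N - 1)) =
        1 - (N : ℝ) / 2 - Real.logb 2 (Real.Gamma ((N : ℝ) / 2)) + h r := by
      rw [uniformRadialDensity_eq hN hΔ hr,
        show 2 ^ (1 - (N : ℝ) / 2) / Real.Gamma ((N : ℝ) / 2) * r ^ (N - 1) *
          radialProfile N K Δ r / r ^ (N - 1) = 2 ^ (1 - (N : ℝ) / 2) / Real.Gamma ((N : ℝ) / 2) *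
          radialProfile N K Δ r by field_simp,
        Real.logb_mul (by positivity) hp.ne', Real.logb_div (by positivity) hG.ne',
        Real.logb_rpow (by norm_num) (by norm_num)]
    beta_reduce
    rw [this]
    ring
  -- The quadratic bound on `h` gives a dominating function built from the mass and second moment of
  -- the output density.
  have hint : Integrable (fun y => h (‖y‖ / σ) * outputDensity N K σ Δ y) := by
    have hm : Measurable (fun y : EuclideanSpace ℝ (Fin N) => h (‖y‖ / σ) *
        outputDensity N K σ Δ y) := by
      refine Measurable.mul ?_ (measurable_outputDensity hN)
      exact (Real.measurable_log.comp ((measurable_radialProfile hN).comp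
        (by fun_prop : Measurable fun y : EuclideanSpace ℝ (Fin N) => ‖y‖ / σ))).div_const _
    refine ((hf2.const_mul (1 / (σ ^ 2 * Real.log 2))).add
      (hf.const_mul ((K * Δ) ^ 2 / Real.log 2))).mono' hm.aestronglyMeasurable
      (ae_of_all _ fun y => ?_)
    have hpos := outputDensity_pos hN hK hσ hΔ y
    rw [norm_mul, Real.norm_eq_abs, Real.norm_eq_abs, abs_of_pos hpos]
    calc _ ≤ ((‖y‖ / σ) ^ 2 + (K * Δ) ^ 2) / Real.log 2 * outputDensity N K σ Δ y := by
          gcongr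
          exact abs_logb_radialProfile_le hN hK hΔ (by positivity)
      _ = _ := by
          simp only [Pi.add_apply]
          field_simp
  have hrad := (integrable_radial_mul_outputDensity_iff (N := N) (K := K) hN hσ hΔ h).1 hint
  have hrad1 := (integrable_radial_mul_outputDensity_iff (N := N) (K := K) hN hσ hΔ
    (fun _ => 1)).1 (by simpa using hf)
  have hI1 := integral_radial_mul_outputDensity (N := N) (K := K) hN hσ hΔ (fun _ => 1)
  simp only [one_mul] at hrad1 hI1
  have hI := integral_radial_mul_outputDensity (N := N) (K := K) hN hσ hΔ h
  refine ⟨?_, ?_, ?_⟩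
  · rw [hy]
    exact (hf.const_mul _).add hint
  · rw [integrableOn_congr_fun hr measurableSet_Ioi]
    exact (hrad1.const_mul _).add hrad
  · rw [hy, integral_add (hf.const_mul _) hint, setIntegral_congr_fun measurableSet_Ioi hr,
      integral_add (hrad1.const_mul _) hrad, integral_const_mul, integral_const_mul, ← hI1, hf1, hI]
    ring

end Output

/-! ### The main theorem -/

theorem corollary2
    {Ω : Type*} [MeasurableSpace Ω] (P : Measure Ω) [IsProbabilityMeasure P]
    (N K : ℕ) (hN : 1 ≤ N) (hK : 1 ≤ K)
    (σ N₀ Δ A : ℝ) (hσ : 0 < σ) (hN₀ : σ ^ 2 = N₀ / 2) (hΔ : 0 < Δ)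
    (X Z : Ω → EuclideanSpace ℝ (Fin N))
    (hX : HasLaw X (multisphere N K (fun _ => (K : ℝ≥0∞)⁻¹) (fun k => k * σ * Δ)) P)
    (hZ : HasLaw Z (gaussianNoise N σ) P)
    (hXZ : IndepFun X Z P)
    (hA : A = (∫ ω, ‖X ω‖ ^ 2 ∂P) / N₀) :
    Δ = Real.sqrt (12 * A / (2 * (K : ℝ) ^ 2 + 3 * K + 1)) ∧
    P.map (fun ω => ‖X ω + Z ω‖ / σ) =
      (volume.restrict (Ioi (0 : ℝ))).withDensity
        (fun r => ENNReal.ofReal (uniformRadialDensity N K Δ r)) ∧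
    MutualInfoDefined X (fun ω => X ω + Z ω) P ∧
    IntegrableOn (fun r : ℝ => uniformRadialDensity N K Δ r *
      Real.logb 2 (uniformRadialDensity N K Δ r / r ^ (N - 1))) (Ioi 0) ∧
    mutualInfo X (fun ω => X ω + Z ω) P =
      -(∫ r in Ioi (0 : ℝ), uniformRadialDensity N K Δ r *
          Real.logb 2 (uniformRadialDensity N K Δ r / r ^ (N - 1)))
        + Real.logb 2 (2 / Real.Gamma ((N : ℝ) / 2))
        - (N : ℝ) / 2 * Real.logb 2 (2 * Real.exp 1) := by
  have hpi := Real.pi_pos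
  have hN' : (0 : ℝ) < N := by exact_mod_cast hN
  have hK' : (0 : ℝ) < K := by exact_mod_cast hK
  have hG : 0 < Real.Gamma ((N : ℝ) / 2) := Real.Gamma_pos_of_pos (by positivity)
  have hXm := hX.aemeasurable
  have hZm := hZ.aemeasurable
  have hYm : AEMeasurable (fun ω => X ω + Z ω) P := hXm.fun_add hZm
  have hlaw : P.map (fun ω => X ω + Z ω) =
      volume.withDensity (fun y => ENNReal.ofReal (outputDensity N K σ Δ y)) := by
    rw [map_add_gaussianNoise_eq_withDensity hσ hXm hZ hXZ, hX.map_eq]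
    congr 1
    ext y
    exact lintegral_gaussDensity_multisphere hN hK hσ hΔ y
  have hmeas := measurable_outputDensity (N := N) (K := K) (σ := σ) (Δ := Δ) hN
  have hnn : ∀ y, 0 ≤ outputDensity N K σ Δ y := fun y => (outputDensity_pos hN hK hσ hΔ y).le
  have : IsProbabilityMeasure
      (volume.withDensity (fun y => ENNReal.ofReal (outputDensity N K σ Δ y))) := by
    rw [← hlaw]
    exact Measure.isProbabilityMeasure_map hYm
  have hf := integrable_of_isFiniteMeasure_withDensity hmeas hnn
  have hf1 := integral_eq_one_of_isProbabilityMeasure_withDensity hmeas hnn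
  -- The input is bounded by the largest radius `KσΔ`; with the square-integrable noise this gives
  -- the output second moment needed for the entropy.
  have hXL : MemLp X 2 P := by
    refine MemLp.of_bound hXm.aestronglyMeasurable (K * σ * Δ) ?_
    have h := ae_norm_le_multisphere N K (fun _ => (K : ℝ≥0∞)⁻¹) (fun k => k * σ * Δ) (K * σ * Δ)
      (fun k hk => by
        have hk' : (k : ℝ) ≤ K := by exact_mod_cast (Finset.mem_Icc.1 hk).2
        rw [abs_of_nonneg (by positivity)]
        gcongr)
    rw [← hX.map_eq] at h
    exact ae_of_ae_map hXm h
  have hZL : MemLp Z 2 P := by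
    have h := memLp_two_gaussianNoise N σ
    rw [← hZ.map_eq, memLp_map_measure_iff (by fun_prop) hZm] at h
    exact h
  have hf2 : Integrable (fun y => ‖y‖ ^ 2 * outputDensity N K σ Δ y) := by
    have h := (hXL.add hZL).integrable_norm_pow (by norm_num)
    have h' : Integrable (fun y => ‖y‖ ^ 2) (P.map (fun ω => X ω + Z ω)) :=
      (integrable_map_measure (by fun_prop) hYm).2 h
    rw [hlaw, integrable_withDensity_iff_integrable_smul' hmeas.ennreal_ofReal (by simp)] at h'
    refine h'.congr (ae_of_all _ fun y => ?_)
    simp only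
    rw [ENNReal.toReal_ofReal (hnn y), smul_eq_mul, mul_comm]
  obtain ⟨hent, hrad, hval⟩ := outputDensity_entropy hN hK hσ hΔ hf hf1 hf2
  obtain ⟨hc1, hc2, hc3⟩ := condDiffEntropy_add_gaussianNoise hσ hXm hZ hXZ
  have hrn := rnDeriv_mul_logb_ae_eq hmeas hnn
  refine ⟨?_, ?_, ⟨⟨?_, ?_⟩, hc1, hc2⟩, hrad, ?_⟩
  · have hX2 : ∫ ω, ‖X ω‖ ^ 2 ∂P = σ ^ 2 * Δ ^ 2 * ((K + 1) * (2 * K + 1) / 6) := by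
      have h := hX.integral_comp (f := fun x => ‖x‖ ^ 2) (by fun_prop)
      simp only [Function.comp_def] at h
      rw [h, integral_norm_sq_multisphere hN K _ (fun k _ => by
        simp [Nat.one_le_iff_ne_zero.1 hK])]
      have e : ∀ k : ℕ, ((K : ℝ≥0∞)⁻¹).toReal * ((k : ℝ) * σ * Δ) ^ 2 =
          (K : ℝ)⁻¹ * σ ^ 2 * Δ ^ 2 * (k : ℝ) ^ 2 := fun k => by simp; ring
      simp_rw [e]
      rw [← Finset.mul_sum, sum_Icc_sq]
      field_simp
    -- Here `2K² + 3K + 1 = (K + 1)(2K + 1)`, and `N₀ = 2σ²` contributes the remaining factor `2`.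
    have : 12 * A / (2 * (K : ℝ) ^ 2 + 3 * K + 1) = Δ ^ 2 := by
      rw [hA, hX2, show N₀ = 2 * σ ^ 2 by linarith]
      field_simp
      ring
    rw [this, Real.sqrt_sq hΔ.le]
  · rw [← map_norm_div_withDensity_outputDensity hN hK hσ hΔ hf, ← hlaw,
      AEMeasurable.map_map_of_aemeasurable (by fun_prop) hYm]
    rfl
  · rw [hlaw]
    exact withDensity_absolutelyContinuous _ _
  · rw [hlaw]
    exact (integrable_congr hrn).2 hent
  -- The terms `N/2 log₂(2πσ²)` of the two entropies cancel; the remaining constant `1 - N/2 - log₂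
  -- Γ(N/2) - N/2 log₂ e` is the claimed one.
  · rw [mutualInfo, hc3, diffEntropy, hlaw, integral_congr_ae hrn, hval,
      Real.logb_div (by norm_num) hG.ne', Real.logb_mul (by norm_num) (Real.exp_pos 1).ne',
      Real.logb_self_eq_one (by norm_num)]
    ring
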